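/- Let $m$ be a positive integer and let $p_1,\dots,p_m\ge 0$ with $p_1+\cdots+p_m=1$. A die with faces $1,\dots,m$, showing face $i$ with probability $p_i$, is rolled repeatedly and independently. Let $S$ be a finite word on the alphabet $[m]=\{1,\dots,m\}$, and let $Y=Y(S)\in\{0,1,2,\dots\}\cup\{\infty\}$ be the number of rolls until $S$ appears, that is, the least $k$ such that the word formed by the first $k$ rolls ends in $S$ (with $Y=\infty$ if there is no such $k$). For a word $w=w_1\cdots w_\ell$ write $|w|=\ell$ and $P(w)=p_{w_1}\cdots p_{w_\ell}$. Let $\mathrm{overlap}(S)$ be the set of all nonempty words that are both a prefix and a suffix of $S$, let $Z(S)$ be the set of all finite words on $[m]$ in which $S$ occurs exactly once, at the end, and let $\Pi_n$ be the set of all set partitions of $[n]=\{1,\dots,n\}$, where $|\pi|$ denotes the number of blocks of $\pi\in\Pi_n$. Let $n\ge 1$ be an integer. 1. If $P(S)>0$ (that is, every letter occurring in $S$ has positive probability), then $E(Y^n)$ is finite and $$E(Y^n)=\sum_{w\in Z(S)}|w|^n\,P(w)=\sum_{\pi\in\Pi_n}|\pi|!\prod_{B\in\pi}\ \sum_{R\in\mathrm{overlap}(S)}\frac{(1-|R|)^{|B|}-(-|R|)^{|B|}}{P(R)}.$$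 2. If $S'$ is the reversal of $S$, then $E(Y(S')^n)=E(Y(S)^n)$ (as elements of $[0,\infty]$). -/

import Mathlib

open MeasureTheory ProbabilityTheory
open scoped ENNReal

/-- The probability `P(w)` of the finite word `w` when the die with face probabilities `p` is
rolled `|w|` times. -/
def wordProb {m : ℕ} (p : Fin m → ℝ) (w : List (Fin m)) : ℝ := (w.map p).prod

/-- The set of overlaps of `S`: the nonempty words which are both a prefix and a suffix of `S`
(`S` itself is included when it is nonempty). -/
def overlaps {m : ℕ} (S : List (Fin m)) : Finset (List (Fin m)) :=
  S.inits.toFinset.filter (fun R => R ≠ [] ∧ R <:+ S)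

theorem mem_overlaps {m : ℕ} (S R : List (Fin m)) :
    R ∈ overlaps S ↔ R ≠ [] ∧ R <+: S ∧ R <:+ S := by
  simp only [overlaps, Finset.mem_filter, List.mem_toFinset, List.mem_inits]
  tauto

/-- The word formed by the first `k` rolls of the infinite sequence of rolls `x`. -/
def firstRolls {m : ℕ} (x : ℕ → Fin m) (k : ℕ) : List (Fin m) :=
  List.ofFn (fun i : Fin k => x i)

/-- The number of rolls until `S` appears: the least `k` such that the first `k` rolls end in `S`
(and `⊤` if `S` never appears). -/
noncomputable def rollCount {m : ℕ} (S : List (Fin m)) (x : ℕ → Fin m) : ℕ∞ :=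
  ⨅ (k : ℕ) (_ : S <:+ firstRolls x k), (k : ℕ∞)

/-- The set `Z(S)` of all finite words in which `S` occurs exactly once, at the end. -/
def endWords {m : ℕ} (S : List (Fin m)) : Set (List (Fin m)) :=
  {w | S <:+ w ∧ ∀ u v : List (Fin m), w = u ++ S ++ v → v = []}

/-- The `n`-th moment `E(Y^n)`, a priori in `[0, ∞]`, of the number `Y` of rolls until `S`
appears, where the `i`-th roll (starting from `0`) is the random variable `X i`. -/
noncomputable def rollMoment {m : ℕ} {Ω : Type*} [MeasurableSpace Ω] (μ : Measure Ω)
    (X : ℕ → Ω → Fin m) (S : List (Fin m)) (n : ℕ) : ℝ≥0∞ :=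
  ∫⁻ ω, ((rollCount S (fun i => X i ω) : ℕ∞) : ℝ≥0∞) ^ n ∂μ

/-! Put a_k = P(Y = k) and b_k = P(Y > k) (`firstProb`, `tailProb`). Suppose S has not appeared in k
rolls and the next |S| rolls spell S. Then S first appears at some time k + |R|, where R is an
overlap of S, and the rest of S follows. Computing the probability both ways and dividing by P(S)
gives b_k = ∑_R a_{k+|R|} / P(R) (`tailProb_eq_sum_overlaps`).

Multiply by (k+1)^n - k^n and sum over k. Summation by parts turns the left side into E(Y^n) - 0^n.
On the right, expanding in powers of j = k + |R| gives ∑_i C(n,i) c_i E(Y^{n-i}), where c_i is the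
overlap sum attached to a block of size i (`moment_recurrence`). As c_0 = 0, this determines all
moments, and the sum over set partitions obeys the same recurrence by marking one block
(`orderedPartitionSum_eq_of_recurrence`). Geometric decay of b_k justifies the summations.

The formula sees S only through the lengths and probabilities of its overlaps, which reversal
preserves. If P(S) = 0, both moments are infinite. -/

/-! ### Set partitions weighted by |π|! and their recurrence. -/

section SetPartitions

variable {α : Type*} [DecidableEq α] [Fintype α]

open Classical in
/-- The families of blocks of the set partitions of `s`. -/
noncomputable def partitionFamilies (s : Finset α) : Finset (Finset (Finset α)) :=
  Finset.univ.filter fun P => (P : Set (Finset α)).PairwiseDisjoint id ∧ P.sup id = s ∧ ∅ ∉ P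

theorem mem_partitionFamilies {s : Finset α} {P : Finset (Finset α)} :
    P ∈ partitionFamilies s ↔
      (P : Set (Finset α)).PairwiseDisjoint id ∧ P.sup id = s ∧ ∅ ∉ P := by
  simp [partitionFamilies]

/-- Partitions of different subsets have different types; their families of blocks share one type,
so blocks can be erased and inserted freely. -/
theorem sum_finpartition_eq_sum_partitionFamilies (s : Finset α) (f : Finset (Finset α) → ℝ) :
    ∑ π : Finpartition s, f π.parts = ∑ P ∈ partitionFamilies s, f P := by
  refine Finset.sum_bij (fun π _ => π.parts) ?_ ?_ ?_ ?_
  · intro π _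
    exact mem_partitionFamilies.2 ⟨π.disjoint, π.sup_parts, π.bot_notMem⟩
  · intro π _ π' _ h
    exact Finpartition.ext h
  · intro P hP
    obtain ⟨h1, h2, h3⟩ := mem_partitionFamilies.1 hP
    exact ⟨⟨P, Finset.supIndep_iff_pairwiseDisjoint.2 h1, h2, h3⟩, Finset.mem_univ _, rfl⟩
  · intro _ _
    rfl

/-- The weight `|π|! ∏ c |B|`, summed over the set partitions of `s`. -/
noncomputable def orderedPartitionSum (c : ℕ → ℝ) (s : Finset α) : ℝ :=
  ∑ P ∈ partitionFamilies s, (P.card.factorial : ℝ) * ∏ B ∈ P, c B.card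

theorem orderedPartitionSum_empty (c : ℕ → ℝ) :
    orderedPartitionSum c (∅ : Finset α) = 1 := by
  have : partitionFamilies (∅ : Finset α) = {∅} := by
    ext P
    rw [mem_partitionFamilies, Finset.mem_singleton]
    constructor
    · rintro ⟨-, h2, h3⟩
      refine Finset.eq_empty_of_forall_notMem fun B hB => h3 ?_
      have : B ⊆ P.sup id := Finset.le_sup (f := id) hB
      rw [h2, Finset.subset_empty] at this
      exact this ▸ hB
    · rintro rfl
      simp
  simp [orderedPartitionSum, this]

theorem erase_mem_partitionFamilies {s : Finset α} {P : Finset (Finset α)} {B : Finset α}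
    (hP : P ∈ partitionFamilies s) (hB : B ∈ P) : P.erase B ∈ partitionFamilies (s \ B) := by
  obtain ⟨h1, h2, h3⟩ := mem_partitionFamilies.1 hP
  refine mem_partitionFamilies.2 ⟨h1.subset (by simp), ?_, fun h => h3 (Finset.mem_of_mem_erase h)⟩
  ext x
  simp only [← h2, Finset.mem_sup, Finset.mem_erase, Finset.mem_sdiff, id]
  constructor
  · rintro ⟨C, ⟨hCB, hC⟩, hx⟩
    exact ⟨⟨C, hC, hx⟩, fun hxB => Finset.disjoint_left.1 (h1 hC hB hCB) hx hxB⟩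
  · rintro ⟨⟨C, hC, hx⟩, hxB⟩
    exact ⟨C, ⟨fun h => hxB (h ▸ hx), hC⟩, hx⟩

theorem insert_mem_partitionFamilies {s B : Finset α} {Q : Finset (Finset α)} (hBs : B ⊆ s)
    (hB : B.Nonempty) (hQ : Q ∈ partitionFamilies (s \ B)) :
    B ∉ Q ∧ insert B Q ∈ partitionFamilies s := by
  obtain ⟨h1, h2, h3⟩ := mem_partitionFamilies.1 hQ
  have hdisj : ∀ C ∈ Q, Disjoint B C := fun C hC => by
    have : C ⊆ s \ B := h2 ▸ Finset.le_sup (f := id) hC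
    exact Finset.disjoint_left.2 fun x hx hxC => (Finset.mem_sdiff.1 (this hxC)).2 hx
  refine ⟨fun h => hB.ne_empty (disjoint_self.1 (hdisj B h)), mem_partitionFamilies.2 ⟨?_, ?_, ?_⟩⟩
  · rw [Finset.coe_insert]
    exact h1.insert fun C hC _ => hdisj C hC
  · rw [Finset.sup_insert, h2]
    exact Finset.union_sdiff_of_subset hBs
  · simp only [Finset.mem_insert, not_or]
    exact ⟨hB.ne_empty.symm, h3⟩

/-- Since |P|! = ∑_{B ∈ P} (|P| - 1)!, the weight counts partitions with a marked block B; removing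
B leaves a partition of `s \ B`. The spurious term B = ∅ vanishes because `c 0 = 0`. -/
theorem orderedPartitionSum_eq_sum_powerset (c : ℕ → ℝ) (hc : c 0 = 0) {s : Finset α}
    (hs : s.Nonempty) :
    orderedPartitionSum c s = ∑ B ∈ s.powerset, c B.card * orderedPartitionSum c (s \ B) := by
  have hsplit : orderedPartitionSum c s = ∑ P ∈ partitionFamilies s, ∑ B ∈ P,
      c B.card * (((P.erase B).card.factorial : ℝ) * ∏ C ∈ P.erase B, c C.card) := by
    refine Finset.sum_congr rfl fun P hP => ?_
    have hne : P.card ≠ 0 := fun h => by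
      rw [Finset.card_eq_zero] at h
      have := (mem_partitionFamilies.1 hP).2.1
      rw [h, Finset.sup_empty] at this
      exact hs.ne_empty this.symm
    rw [Finset.sum_congr rfl (g := fun _ => (((P.card - 1).factorial : ℝ) * ∏ C ∈ P, c C.card)),
      Finset.sum_const, nsmul_eq_mul, ← mul_assoc, ← Nat.cast_mul, Nat.mul_factorial_pred hne]
    intro B hB
    rw [Finset.card_erase_of_mem hB, ← Finset.mul_prod_erase P _ hB]
    ring
  have hpow : ∑ B ∈ s.powerset, c B.card * orderedPartitionSum c (s \ B) =
      ∑ B ∈ s.powerset.filter Finset.Nonempty, c B.card * orderedPartitionSum c (s \ B) := by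
    refine (Finset.sum_filter_of_ne fun B _ h => ?_).symm
    by_contra hB
    rw [Finset.not_nonempty_iff_eq_empty] at hB
    exact h (by simp [hB, hc])
  rw [hsplit, hpow]
  simp only [orderedPartitionSum, Finset.mul_sum]
  rw [Finset.sum_sigma', Finset.sum_sigma']
  refine Finset.sum_bij' (fun x _ => ⟨x.2, x.1.erase x.2⟩) (fun y _ => ⟨insert y.1 y.2, y.1⟩)
    ?_ ?_ ?_ ?_ ?_
  · rintro ⟨P, B⟩ h
    simp only [Finset.mem_sigma] at h
    simp only [Finset.mem_sigma, Finset.mem_filter, Finset.mem_powerset]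
    obtain ⟨-, h2, h3⟩ := mem_partitionFamilies.1 h.1
    exact ⟨⟨h2 ▸ Finset.le_sup (f := id) h.2,
      Finset.nonempty_iff_ne_empty.2 fun hB => h3 (hB ▸ h.2)⟩, erase_mem_partitionFamilies h.1 h.2⟩
  · rintro ⟨B, Q⟩ h
    simp only [Finset.mem_sigma, Finset.mem_filter, Finset.mem_powerset] at h
    simp only [Finset.mem_sigma]
    exact ⟨(insert_mem_partitionFamilies h.1.1 h.1.2 h.2).2, Finset.mem_insert_self _ _⟩
  · rintro ⟨P, B⟩ h
    simp only [Finset.mem_sigma] at h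
    simp [Finset.insert_erase h.2]
  · rintro ⟨B, Q⟩ h
    simp only [Finset.mem_sigma, Finset.mem_filter, Finset.mem_powerset] at h
    simp [Finset.erase_insert (insert_mem_partitionFamilies h.1.1 h.1.2 h.2).1]
  · rintro ⟨P, B⟩ h
    rfl

theorem orderedPartitionSum_eq_of_recurrence (c M : ℕ → ℝ) (hc : c 0 = 0)
    (hM : ∀ n, M n = 0 ^ n + ∑ i ∈ Finset.range (n + 1), (n.choose i : ℝ) * (c i * M (n - i)))
    (s : Finset α) : orderedPartitionSum c s = M s.card := by
  induction s using Finset.strongInduction with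
  | H s ih =>
    rcases s.eq_empty_or_nonempty with rfl | hs
    · rw [orderedPartitionSum_empty, Finset.card_empty, hM]
      simp [hc]
    · rw [orderedPartitionSum_eq_sum_powerset c hc hs, hM, zero_pow hs.card_ne_zero, zero_add]
      rw [Finset.sum_congr rfl (g := fun B : Finset α => c B.card * M (s.card - B.card)),
        Finset.sum_powerset_apply_card (fun i => c i * M (s.card - i))]
      · simp [nsmul_eq_mul]
      · intro B hB
        rw [Finset.mem_powerset] at hB
        rcases B.eq_empty_or_nonempty with rfl | hBn
        · simp [hc]
        · rw [ih _ (Finset.sdiff_ssubset hB hBn), Finset.card_sdiff_of_subset hB]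

end SetPartitions

/-! ### Geometric tails and the moment recurrence for real sequences. -/

theorem exists_geometric_bound {b : ℕ → ℝ} {q : ℝ} {s : ℕ} (hb0 : ∀ k, 0 ≤ b k)
    (hb1 : ∀ k, b k ≤ 1) (hanti : Antitone b) (hq : 0 < q) (hq1 : q ≤ 1)
    (hstep : ∀ k, b (k + s) ≤ (1 - q) * b k) :
    ∃ C ρ : ℝ, 0 < ρ ∧ ρ < 1 ∧ ∀ k, b k ≤ C * ρ ^ k := by
  -- Bernoulli gives (1 - t)^(s+1) ≥ 1 - q/2 ≥ 1 - q. The factor 2 keeps 1 - t positive when q = 1,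
  -- and s + 1 replaces s to allow s = 0.
  set t : ℝ := q / (2 * (s + 1 : ℕ)) with ht
  have hs : (0 : ℝ) < (s + 1 : ℕ) := by positivity
  have hs1 : (1 : ℝ) ≤ (s + 1 : ℕ) := by exact_mod_cast Nat.le_add_left 1 s
  have ht0 : 0 < t := by positivity
  have htq : (s + 1 : ℕ) * t = q / 2 := by rw [ht]; field_simp
  have ht1 : t ≤ q / 2 := by nlinarith
  have hρ0 : 0 < 1 - t := by linarith
  have hbern : 1 - q ≤ (1 - t) ^ (s + 1) := by
    have := one_add_mul_le_pow (a := -t) (by linarith) (s + 1)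
    rw [← sub_eq_add_neg] at this
    linarith
  -- The constant makes the bound at least 1 for all k < s + 1, where only b ≤ 1 is available.
  refine ⟨((1 - t) ^ (s + 1))⁻¹, 1 - t, hρ0, by linarith, fun k => ?_⟩
  induction k using Nat.strong_induction_on with
  | _ k ih =>
    by_cases hk : k < s + 1
    · refine (hb1 k).trans ?_
      rw [inv_mul_eq_div, one_le_div (by positivity)]
      exact pow_le_pow_of_le_one hρ0.le (by linarith) hk.le
    · obtain ⟨j, rfl⟩ := Nat.exists_eq_add_of_le (not_lt.1 hk)
      have h1 : b (s + 1 + j) ≤ b (j + s) := hanti (by omega)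
      have h2 := ih j (by omega)
      calc b (s + 1 + j) ≤ (1 - q) * b j := h1.trans (hstep j)
        _ ≤ (1 - t) ^ (s + 1) * b j := mul_le_mul_of_nonneg_right hbern (hb0 j)
        _ ≤ (1 - t) ^ (s + 1) * (((1 - t) ^ (s + 1))⁻¹ * (1 - t) ^ j) :=
            mul_le_mul_of_nonneg_left h2 (by positivity)
        _ = ((1 - t) ^ (s + 1))⁻¹ * (1 - t) ^ (s + 1 + j) := by rw [pow_add]; ring

theorem summable_pow_mul_of_geometric_bound {b : ℕ → ℝ} {C ρ : ℝ} (hb0 : ∀ k, 0 ≤ b k)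
    (hρ : 0 < ρ) (hρ1 : ρ < 1) (hb : ∀ k, b k ≤ C * ρ ^ k) (n : ℕ) :
    Summable fun k : ℕ => (k : ℝ) ^ n * b k := by
  have h := (summable_pow_mul_geometric_of_norm_lt_one (R := ℝ) n
    (r := ρ) (by rwa [Real.norm_of_nonneg hρ.le])).mul_left C
  refine Summable.of_nonneg_of_le (fun k => mul_nonneg (by positivity) (hb0 k)) (fun k => ?_) h
  calc (k : ℝ) ^ n * b k ≤ (k : ℝ) ^ n * (C * ρ ^ k) :=
        mul_le_mul_of_nonneg_left (hb k) (by positivity)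
    _ = C * ((k : ℝ) ^ n * ρ ^ k) := by ring

theorem summable_pow_mul_of_le_of_summable {a b : ℕ → ℝ} (ha0 : ∀ k, 0 ≤ a k)
    (hab : ∀ k, a (k + 1) ≤ b k) (hb : ∀ n : ℕ, Summable fun k : ℕ => (k : ℝ) ^ n * b k) (n : ℕ) :
    Summable fun k : ℕ => (k : ℝ) ^ n * a k := by
  rw [← summable_nat_add_iff 1]
  have h : Summable fun k : ℕ => ∑ i ∈ Finset.range (n + 1), (n.choose i : ℝ) * ((k : ℝ) ^ i * b k) :=
    summable_sum fun i _ => (hb i).mul_left _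
  refine Summable.of_nonneg_of_le (fun k => mul_nonneg (by positivity) (ha0 _)) (fun k => ?_) h
  calc ((k + 1 : ℕ) : ℝ) ^ n * a (k + 1) ≤ ((k + 1 : ℕ) : ℝ) ^ n * b k :=
        mul_le_mul_of_nonneg_left (hab k) (by positivity)
    _ = _ := by
      push_cast
      rw [add_pow, Finset.sum_mul]
      exact Finset.sum_congr rfl fun i _ => by simp; ring

/-- Summation by parts for the tails `b` of a distribution `a` on `ℕ`. -/
theorem tsum_tail_mul_sub_pow {a b : ℕ → ℝ} (hab0 : a 0 + b 0 = 1)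
    (hab : ∀ k, b k = b (k + 1) + a (k + 1)) {n : ℕ}
    (ha : Summable fun k : ℕ => (k : ℝ) ^ n * a k) (hb : Summable fun k : ℕ => (k : ℝ) ^ n * b k) :
    ∑' k : ℕ, (((k : ℝ) + 1) ^ n - (k : ℝ) ^ n) * b k = ∑' k : ℕ, (k : ℝ) ^ n * a k - 0 ^ n := by
  have ha' := (summable_nat_add_iff 1).2 ha
  have hb' := (summable_nat_add_iff 1).2 hb
  have hterm : ∀ k : ℕ, (((k : ℝ) + 1) ^ n - (k : ℝ) ^ n) * b k =
      ((k + 1 : ℕ) : ℝ) ^ n * b (k + 1) + ((k + 1 : ℕ) : ℝ) ^ n * a (k + 1) - (k : ℝ) ^ n * b k := by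
    intro k
    push_cast
    linear_combination ((k : ℝ) + 1) ^ n * hab k
  rw [tsum_congr hterm, (hb'.add ha').tsum_sub hb, hb'.tsum_add ha', ha.tsum_eq_zero_add,
    hb.tsum_eq_zero_add]
  push_cast
  -- The boundary terms at k = 0 combine to 0^n (a 0 + b 0) = 0^n.
  linear_combination - (0 : ℝ) ^ n * hab0

theorem moment_recurrence {ι : Type*} {O : Finset ι} {r : ι → ℕ} {P : ι → ℝ} {a b : ℕ → ℝ}
    (hab0 : a 0 + b 0 = 1) (hab : ∀ k, b k = b (k + 1) + a (k + 1))
    (hr : ∀ R ∈ O, ∀ k < r R, a k = 0) (hO : ∀ k, b k = ∑ R ∈ O, a (k + r R) / P R)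
    (ha : ∀ n : ℕ, Summable fun k : ℕ => (k : ℝ) ^ n * a k)
    (hb : ∀ n : ℕ, Summable fun k : ℕ => (k : ℝ) ^ n * b k) (n : ℕ) :
    ∑' k : ℕ, (k : ℝ) ^ n * a k = 0 ^ n + ∑ i ∈ Finset.range (n + 1), (n.choose i : ℝ) *
      ((∑ R ∈ O, ((1 - (r R : ℝ)) ^ i - (-(r R : ℝ)) ^ i) / P R) *
        ∑' k : ℕ, (k : ℝ) ^ (n - i) * a k) := by
  set M : ℕ → ℝ := fun j => ∑' k : ℕ, (k : ℝ) ^ j * a k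
  have hR : ∀ R ∈ O, HasSum
      (fun k : ℕ => (((k : ℝ) + 1) ^ n - (k : ℝ) ^ n) * (a (k + r R) / P R))
      (∑ i ∈ Finset.range (n + 1), (n.choose i : ℝ) *
        (((1 - (r R : ℝ)) ^ i - (-(r R : ℝ)) ^ i) / P R * M (n - i))) := by
    intro R hRO
    have h1 : HasSum (fun j : ℕ => ∑ i ∈ Finset.range (n + 1), (n.choose i : ℝ) *
        (((1 - (r R : ℝ)) ^ i - (-(r R : ℝ)) ^ i) / P R * ((j : ℝ) ^ (n - i) * a j)))
        (∑ i ∈ Finset.range (n + 1), (n.choose i : ℝ) *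
        (((1 - (r R : ℝ)) ^ i - (-(r R : ℝ)) ^ i) / P R * M (n - i))) :=
      hasSum_sum fun i _ => (((ha (n - i)).hasSum).mul_left _).mul_left _
    -- The sum over j may start at j = `r R`, since `a` vanishes below it; put j = k + `r R`.
    rw [← hasSum_nat_add_iff' (r R), Finset.sum_eq_zero (s := Finset.range (r R)), sub_zero] at h1
    · refine h1.congr_fun ?_
      intro k
      have hp : ∀ y : ℝ, (y + ((k + r R : ℕ) : ℝ)) ^ n =
          ∑ i ∈ Finset.range (n + 1), y ^ i * ((k + r R : ℕ) : ℝ) ^ (n - i) * (n.choose i : ℝ) :=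
        fun y => add_pow _ _ _
      have e1 : (k : ℝ) + 1 = (1 - (r R : ℝ)) + ((k + r R : ℕ) : ℝ) := by push_cast; ring
      have e2 : (k : ℝ) = -(r R : ℝ) + ((k + r R : ℕ) : ℝ) := by push_cast; ring
      rw [e1, hp]
      conv_lhs => rw [e2, hp]
      rw [← Finset.sum_sub_distrib, Finset.sum_mul]
      exact Finset.sum_congr rfl fun i _ => by ring
    · intro j hj
      rw [hr R hRO j (Finset.mem_range.1 hj)]
      simp
  have hsum := hasSum_sum hR
  have hkey := tsum_tail_mul_sub_pow hab0 hab (ha n) (hb n)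
  have : ∀ k : ℕ, (((k : ℝ) + 1) ^ n - (k : ℝ) ^ n) * b k =
      ∑ R ∈ O, (((k : ℝ) + 1) ^ n - (k : ℝ) ^ n) * (a (k + r R) / P R) := fun k => by
    rw [hO k, Finset.mul_sum]
  rw [tsum_congr this, hsum.tsum_eq] at hkey
  rw [← sub_eq_iff_eq_add', ← hkey, Finset.sum_comm]
  refine Finset.sum_congr rfl fun i _ => ?_
  rw [Finset.sum_mul, Finset.mul_sum]

/-! ### Combinatorics of words: first occurrences and overlaps. -/

section Words

variable {m : ℕ}

theorem firstRolls_eq_map_range (x : ℕ → Fin m) (k : ℕ) :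
    firstRolls x k = (List.range k).map x := by
  refine List.ext_getElem (by simp [firstRolls]) fun i h1 h2 => ?_
  simp [firstRolls]

@[simp]
theorem length_firstRolls (x : ℕ → Fin m) (k : ℕ) : (firstRolls x k).length = k := by
  simp [firstRolls]

theorem take_firstRolls (x : ℕ → Fin m) {j k : ℕ} (h : j ≤ k) :
    (firstRolls x k).take j = firstRolls x j := by
  rw [firstRolls_eq_map_range, firstRolls_eq_map_range, ← List.map_take, List.take_range,
    min_eq_left h]

theorem firstRolls_add_eq_append_iff (x : ℕ → Fin m) (k : ℕ) (v : List (Fin m)) :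
    firstRolls x (k + v.length) = firstRolls x k ++ v ↔ v <:+ firstRolls x (k + v.length) := by
  constructor
  · intro h
    exact h ▸ List.suffix_append _ _
  · rintro ⟨u, hu⟩
    have hlen : u.length = k := by simpa using congrArg List.length hu
    rw [← take_firstRolls x (Nat.le_add_right k v.length), ← hu, ← hlen, List.take_left]

theorem wordProb_append (p : Fin m → ℝ) (u v : List (Fin m)) :
    wordProb p (u ++ v) = wordProb p u * wordProb p v := by
  simp [wordProb]

theorem wordProb_nonneg {p : Fin m → ℝ} (hp : ∀ a, 0 ≤ p a) (w : List (Fin m)) :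
    0 ≤ wordProb p w :=
  List.prod_nonneg (by simpa using fun a _ => hp a)

theorem wordProb_reverse (p : Fin m → ℝ) (w : List (Fin m)) :
    wordProb p w.reverse = wordProb p w := by
  simp [wordProb, List.prod_reverse]

theorem sum_overlaps_reverse {p : Fin m → ℝ} (S : List (Fin m)) (f : ℕ → ℝ → ℝ) :
    ∑ R ∈ overlaps S.reverse, f R.length (wordProb p R) =
      ∑ R ∈ overlaps S, f R.length (wordProb p R) := by
  have key : ∀ T R : List (Fin m), R ∈ overlaps T → R.reverse ∈ overlaps T.reverse := by
    intro T R h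
    obtain ⟨h0, h1, h2⟩ := (mem_overlaps _ _).1 h
    exact (mem_overlaps _ _).2
      ⟨by simpa using h0, List.reverse_prefix.2 h2, List.reverse_suffix.2 h1⟩
  refine Finset.sum_bij' (fun R _ => R.reverse) (fun R _ => R.reverse)
    (fun R h => by simpa using key _ _ h) (fun R h => key _ _ h) (by simp) (by simp) fun R _ => ?_
  rw [List.length_reverse, wordProb_reverse]

/-- An occurrence of S is determined by its end position, so uniqueness becomes a condition on
proper prefixes. -/
theorem mem_endWords_iff {S w : List (Fin m)} :
    w ∈ endWords S ↔ S <:+ w ∧ ∀ j < w.length, ¬ S <:+ w.take j := by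
  refine and_congr_right fun _ => ⟨fun h j hj => ?_, fun h u v hw => ?_⟩
  · rintro ⟨u, hu⟩
    have := h u (w.drop j) (by rw [hu, List.take_append_drop])
    rw [List.drop_eq_nil_iff] at this
    omega
  · by_contra hv
    have hpos := List.length_pos_iff.2 hv
    refine h (u ++ S).length (by rw [hw]; simp only [List.length_append] at *; omega) ?_
    rw [hw, List.take_left]
    exact List.suffix_append _ _

/-- The words in which `S` does not occur. -/
def avoidingWords (S : List (Fin m)) : Set (List (Fin m)) :=
  {w | ∀ j ≤ w.length, ¬ S <:+ w.take j}

theorem firstRolls_mem_endWords_iff {S : List (Fin m)} {x : ℕ → Fin m} {k : ℕ} :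
    firstRolls x k ∈ endWords S ↔ S <:+ firstRolls x k ∧ ∀ j < k, ¬ S <:+ firstRolls x j := by
  rw [mem_endWords_iff, length_firstRolls]
  exact and_congr_right fun _ => forall₂_congr fun j hj => by rw [take_firstRolls x hj.le]

theorem firstRolls_mem_avoidingWords_iff {S : List (Fin m)} {x : ℕ → Fin m} {k : ℕ} :
    firstRolls x k ∈ avoidingWords S ↔ ∀ j ≤ k, ¬ S <:+ firstRolls x j := by
  rw [avoidingWords, Set.mem_ofPred_eq, length_firstRolls]
  exact forall₂_congr fun j hj => by rw [take_firstRolls x hj]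

theorem rollCount_eq_of_mem_endWords {S : List (Fin m)} {x : ℕ → Fin m} {k : ℕ}
    (h : firstRolls x k ∈ endWords S) : rollCount S x = k := by
  obtain ⟨h1, h2⟩ := firstRolls_mem_endWords_iff.1 h
  refine le_antisymm (iInf₂_le k h1) (le_iInf₂ fun j hj => ?_)
  exact_mod_cast not_lt.1 fun hjk => h2 j hjk hj

theorem eq_of_firstRolls_mem_endWords {S : List (Fin m)} {x : ℕ → Fin m} {j k : ℕ}
    (hj : firstRolls x j ∈ endWords S) (hk : firstRolls x k ∈ endWords S) : j = k := by
  have := (rollCount_eq_of_mem_endWords hj).symm.trans (rollCount_eq_of_mem_endWords hk)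
  exact_mod_cast this

theorem exists_le_mem_endWords_of_suffix {S : List (Fin m)} {x : ℕ → Fin m} {k : ℕ}
    (h : S <:+ firstRolls x k) : ∃ j ≤ k, firstRolls x j ∈ endWords S := by
  classical
  have hex : ∃ k, S <:+ firstRolls x k := ⟨k, h⟩
  exact ⟨Nat.find hex, Nat.find_min' hex h,
    firstRolls_mem_endWords_iff.2 ⟨Nat.find_spec hex, fun j hj => Nat.find_min hex hj⟩⟩

theorem exists_mem_endWords_iff {S : List (Fin m)} {x : ℕ → Fin m} :
    (∃ k, firstRolls x k ∈ endWords S) ↔ ¬ ∀ k, firstRolls x k ∈ avoidingWords S := by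
  simp only [firstRolls_mem_avoidingWords_iff]
  constructor
  · rintro ⟨k, hk⟩ h
    exact h k k le_rfl (firstRolls_mem_endWords_iff.1 hk).1
  · intro h
    push Not at h
    obtain ⟨_, j, _, hj⟩ := h
    obtain ⟨i, -, hi⟩ := exists_le_mem_endWords_of_suffix hj
    exact ⟨i, hi⟩

theorem eq_append_drop_of_mem_overlaps {S R : List (Fin m)} (h : R ∈ overlaps S) :
    R ++ S.drop R.length = S := by
  obtain ⟨t, ht⟩ := ((mem_overlaps _ _).1 h).2.1
  rw [← ht, List.drop_left]

theorem length_drop_overlap {S R : List (Fin m)} (h : R ∈ overlaps S) :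
    R.length + (S.drop R.length).length = S.length := by
  rw [← List.length_append, eq_append_drop_of_mem_overlaps h]

/-- Appending `S` to a word avoiding `S` creates the first occurrence of `S` after one of the
overlaps of `S`. -/
theorem avoiding_and_append_iff (S : List (Fin m)) (x : ℕ → Fin m) (k : ℕ) :
    (firstRolls x k ∈ avoidingWords S ∧ firstRolls x (k + S.length) = firstRolls x k ++ S) ↔
      ∃ R ∈ overlaps S, firstRolls x (k + R.length) ∈ endWords S ∧
        firstRolls x (k + R.length + (S.drop R.length).length) =
          firstRolls x (k + R.length) ++ S.drop R.length := by
  constructor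
  · rintro ⟨h1, h2⟩
    rw [firstRolls_mem_avoidingWords_iff] at h1
    -- The first occurrence ends at some j with k < j ≤ k + |S|; the overlap is the part of S rolled
    -- between times k and j.
    obtain ⟨j, hj, hjS⟩ := exists_le_mem_endWords_of_suffix
      ((firstRolls_add_eq_append_iff x k S).1 h2)
    have hS := (firstRolls_mem_endWords_iff.1 hjS).1
    have hkj : k < j := not_le.1 fun h => h1 j h hS
    obtain ⟨r, rfl⟩ := Nat.exists_eq_add_of_le hkj.le
    have hr : r ≤ S.length := by omega
    have hlen : (S.take r).length = r := by simpa using hr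
    have htake : firstRolls x (k + r) = firstRolls x k ++ S.take r := by
      rw [← take_firstRolls x hj, h2, List.take_append, length_firstRolls,
        List.take_of_length_le (by simp)]
      simp
    refine ⟨S.take r, (mem_overlaps _ _).2 ⟨?_, List.take_prefix _ _, ?_⟩, ?_⟩
    · exact List.ne_nil_of_length_pos (by omega)
    -- Both `S.take r` and S end the word of the first k + r rolls, so the shorter is a suffix of
    -- the longer.
    · exact List.suffix_of_suffix_length_le (htake ▸ List.suffix_append _ _) hS (by omega)
    · rw [hlen]
      refine ⟨hjS, ?_⟩
      rw [htake, List.append_assoc, List.take_append_drop, ← h2, List.length_drop]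
      congr 1
      omega
  · rintro ⟨R, hR, h1, h2⟩
    have hlen := length_drop_overlap hR
    have happ := eq_append_drop_of_mem_overlaps hR
    obtain ⟨h0, -, hsuf⟩ := (mem_overlaps _ _).1 hR
    have hpos := List.length_pos_iff.2 h0
    obtain ⟨h3, h4⟩ := firstRolls_mem_endWords_iff.1 h1
    refine ⟨firstRolls_mem_avoidingWords_iff.2 fun j hj => h4 j (by omega), ?_⟩
    -- R is a suffix of S, so the rolls after time k spell R and then the rest of S.
    rw [(firstRolls_add_eq_append_iff x k R).2 (hsuf.trans h3), List.append_assoc, happ,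
      add_assoc, hlen] at h2
    exact h2

end Words

/-! ### Probabilities of roll events and the overlap identity. -/

section Rolls

variable {m : ℕ} {Ω : Type*} {p : Fin m → ℝ} {X : ℕ → Ω → Fin m} {S : List (Fin m)}

/-- The event that the word formed by the first `k` rolls belongs to `A`. -/
def rollsEvent (X : ℕ → Ω → Fin m) (k : ℕ) (A : Set (List (Fin m))) : Set Ω :=
  {ω | firstRolls (fun i => X i ω) k ∈ A}

/-- The event that the first `k` rolls form a word of `A`, and are followed by `v`. -/
def rollsThenEvent (X : ℕ → Ω → Fin m) (k : ℕ) (A : Set (List (Fin m))) (v : List (Fin m)) :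
    Set Ω :=
  {ω | firstRolls (fun i => X i ω) k ∈ A ∧
    firstRolls (fun i => X i ω) (k + v.length) = firstRolls (fun i => X i ω) k ++ v}

/-- Supplies measurability: the event depends only on the first k + |v| rolls. -/
theorem rollsThenEvent_eq (k : ℕ) (A : Set (List (Fin m))) (v : List (Fin m)) :
    rollsThenEvent X k A v =
      rollsEvent X (k + v.length) {w | w.take k ∈ A ∧ w = w.take k ++ v} := by
  ext ω
  simp only [rollsThenEvent, rollsEvent, Set.mem_ofPred_eq,
    take_firstRolls _ (Nat.le_add_right k v.length)]

theorem rollsEvent_avoidingWords_antitone :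
    Antitone fun k => rollsEvent X k (avoidingWords S) := by
  intro j k hjk ω h
  exact firstRolls_mem_avoidingWords_iff.2 fun i hi =>
    firstRolls_mem_avoidingWords_iff.1 h i (hi.trans hjk)

variable [MeasurableSpace Ω] {μ : Measure Ω}

theorem measurableSet_rollsEvent (hX : ∀ i, Measurable (X i)) (k : ℕ) (A : Set (List (Fin m))) :
    MeasurableSet (rollsEvent X k A) := by
  have hm : Measurable fun ω => fun i : Fin k => X i ω := measurable_pi_lambda _ fun i => hX i
  exact hm ((Set.to_countable {f : Fin k → Fin m | List.ofFn f ∈ A}).measurableSet)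

theorem measure_rollsEvent_singleton (hp : ∀ a, 0 ≤ p a) (hindep : iIndepFun X μ)
    (hlaw : ∀ i a, μ {ω | X i ω = a} = ENNReal.ofReal (p a)) (w : List (Fin m)) :
    μ (rollsEvent X w.length {w}) = ENNReal.ofReal (wordProb p w) := by
  have hset : rollsEvent X w.length {w} =
      ⋂ i ∈ Finset.range w.length, X i ⁻¹' {a | w[i]? = some a} := by
    ext ω
    simp only [rollsEvent, Set.mem_ofPred_eq, Set.mem_singleton_iff, Set.mem_iInter,
      Finset.mem_range, Set.mem_preimage]
    constructor
    · intro h i hi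
      rw [← h]
      simp [firstRolls, hi]
    · intro h
      refine List.ext_getElem (by simp) fun i h1 h2 => ?_
      have := h i h2
      rw [List.getElem?_eq_getElem h2, Option.some_inj] at this
      simp [firstRolls, this]
  rw [hset, hindep.measure_inter_preimage_eq_mul _ fun i _ => (Set.to_countable _).measurableSet,
    Finset.prod_range, wordProb, ← Fin.prod_univ_fun_getElem w p,
    ENNReal.ofReal_prod_of_nonneg fun i _ => hp _]
  refine Finset.prod_congr rfl fun i _ => ?_
  rw [← hlaw i (w[(i : ℕ)])]
  congr 1
  ext ω
  simp [eq_comm]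

/-- Splitting over the words w of A of length k reduces this to P(wv) = P(w)P(v). -/
theorem measure_rollsThenEvent (hp : ∀ a, 0 ≤ p a) (hX : ∀ i, Measurable (X i))
    (hindep : iIndepFun X μ) (hlaw : ∀ i a, μ {ω | X i ω = a} = ENNReal.ofReal (p a))
    (k : ℕ) (A : Set (List (Fin m))) (v : List (Fin m)) :
    μ (rollsThenEvent X k A v) = μ (rollsEvent X k A) * ENNReal.ofReal (wordProb p v) := by
  have hthen : ∀ v : List (Fin m), μ (rollsThenEvent X k A v) =
      ∑' w : {w : List (Fin m) // w ∈ A ∧ w.length = k}, ENNReal.ofReal (wordProb p (w.1 ++ v)) := by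
    intro v
    have hset : rollsThenEvent X k A v = ⋃ w : {w : List (Fin m) // w ∈ A ∧ w.length = k},
        rollsEvent X (w.1 ++ v).length {w.1 ++ v} := by
      ext ω
      simp only [rollsThenEvent, rollsEvent, Set.mem_ofPred_eq, Set.mem_iUnion,
        Set.mem_singleton_iff, Subtype.exists]
      constructor
      · rintro ⟨h1, h2⟩
        exact ⟨_, ⟨h1, by simp⟩, by simpa using h2⟩
      · rintro ⟨w, ⟨hw, rfl⟩, h⟩
        rw [List.length_append] at h
        have : firstRolls (fun i => X i ω) w.length = w := by
          rw [← take_firstRolls _ (Nat.le_add_right w.length v.length), h, List.take_left]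
        rw [this]
        exact ⟨hw, h⟩
    rw [hset, measure_iUnion]
    · exact tsum_congr fun w => measure_rollsEvent_singleton hp hindep hlaw _
    · intro w w' hne
      refine Set.disjoint_left.2 fun ω h h' => hne ?_
      simp only [rollsEvent, Set.mem_ofPred_eq, Set.mem_singleton_iff, List.length_append, w.2.2,
        w'.2.2] at h h'
      exact Subtype.ext (List.append_cancel_right (h.symm.trans h'))
    · exact fun w => measurableSet_rollsEvent hX _ _
  have hnil : rollsEvent X k A = rollsThenEvent X k A [] := by
    ext ω
    simp [rollsEvent, rollsThenEvent]
  rw [hnil, hthen, hthen, ← ENNReal.tsum_mul_right]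
  refine tsum_congr fun w => ?_
  rw [List.append_nil, wordProb_append, ENNReal.ofReal_mul (wordProb_nonneg hp _)]

theorem measureReal_rollsThenEvent (hp : ∀ a, 0 ≤ p a) (hX : ∀ i, Measurable (X i))
    (hindep : iIndepFun X μ) (hlaw : ∀ i a, μ {ω | X i ω = a} = ENNReal.ofReal (p a))
    (k : ℕ) (A : Set (List (Fin m))) (v : List (Fin m)) :
    μ.real (rollsThenEvent X k A v) = μ.real (rollsEvent X k A) * wordProb p v := by
  rw [Measure.real, measure_rollsThenEvent hp hX hindep hlaw, ENNReal.toReal_mul,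
    ENNReal.toReal_ofReal (wordProb_nonneg hp _), Measure.real]

/-- The probability that `S` appears for the first time at the `k`-th roll. -/
noncomputable def firstProb (μ : Measure Ω) (X : ℕ → Ω → Fin m) (S : List (Fin m)) (k : ℕ) : ℝ :=
  μ.real (rollsEvent X k (endWords S))

/-- The probability that `S` does not appear in the first `k` rolls. -/
noncomputable def tailProb (μ : Measure Ω) (X : ℕ → Ω → Fin m) (S : List (Fin m)) (k : ℕ) : ℝ :=
  μ.real (rollsEvent X k (avoidingWords S))

theorem firstProb_eq_zero_of_lt {k : ℕ} (hk : k < S.length) : firstProb μ X S k = 0 := by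
  have : rollsEvent X k (endWords S) = ∅ := by
    refine Set.eq_empty_of_forall_notMem fun ω h => ?_
    have := (firstRolls_mem_endWords_iff.1 h).1.length_le
    rw [length_firstRolls] at this
    omega
  rw [firstProb, this, measureReal_empty]

variable [IsProbabilityMeasure μ]

theorem firstProb_add_tailProb_zero (hX : ∀ i, Measurable (X i)) :
    firstProb μ X S 0 + tailProb μ X S 0 = 1 := by
  rw [firstProb, tailProb, ← measureReal_union _ (measurableSet_rollsEvent hX _ _)]
  · convert probReal_univ (μ := μ)
    refine Set.eq_univ_of_forall fun ω => ?_
    simp only [rollsEvent, Set.mem_union, Set.mem_ofPred_eq, firstRolls_mem_endWords_iff,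
      firstRolls_mem_avoidingWords_iff, Nat.le_zero, forall_eq]
    simp [em]
  · refine Set.disjoint_left.2 fun ω h h' => ?_
    exact firstRolls_mem_avoidingWords_iff.1 h' 0 le_rfl (firstRolls_mem_endWords_iff.1 h).1

theorem tailProb_eq_succ_add (hX : ∀ i, Measurable (X i)) (k : ℕ) :
    tailProb μ X S k = tailProb μ X S (k + 1) + firstProb μ X S (k + 1) := by
  rw [firstProb, tailProb, tailProb, ← measureReal_union _ (measurableSet_rollsEvent hX _ _)]
  · congr 1
    ext ω
    simp only [rollsEvent, Set.mem_union, Set.mem_ofPred_eq, firstRolls_mem_endWords_iff,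
      firstRolls_mem_avoidingWords_iff, Nat.lt_succ_iff, Nat.le_succ_iff, or_imp, forall_and,
      forall_eq]
    tauto
  · refine Set.disjoint_left.2 fun ω h h' => ?_
    exact firstRolls_mem_avoidingWords_iff.1 h (k + 1) le_rfl (firstRolls_mem_endWords_iff.1 h').1

/-- Among sequences avoiding S up to time k, a proportion P(S) spells S in the next |S| rolls and so
leaves the tail event. -/
theorem tailProb_add_length_le (hp : ∀ a, 0 ≤ p a) (hX : ∀ i, Measurable (X i))
    (hindep : iIndepFun X μ) (hlaw : ∀ i a, μ {ω | X i ω = a} = ENNReal.ofReal (p a)) (k : ℕ) :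
    tailProb μ X S (k + S.length) ≤ (1 - wordProb p S) * tailProb μ X S k := by
  have hthen := measureReal_rollsThenEvent hp hX hindep hlaw k (avoidingWords S) S
  have hdisj : Disjoint (rollsEvent X (k + S.length) (avoidingWords S))
      (rollsThenEvent X k (avoidingWords S) S) := by
    refine Set.disjoint_left.2 fun ω h h' => ?_
    exact firstRolls_mem_avoidingWords_iff.1 h _ le_rfl
      ((firstRolls_add_eq_append_iff _ k S).1 h'.2)
  have hle : μ.real (rollsEvent X (k + S.length) (avoidingWords S) ∪
      rollsThenEvent X k (avoidingWords S) S) ≤ tailProb μ X S k :=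
    measureReal_mono (Set.union_subset (rollsEvent_avoidingWords_antitone (Nat.le_add_right _ _))
      fun ω h => h.1)
  rw [measureReal_union hdisj (rollsThenEvent_eq (X := X) k _ S ▸ measurableSet_rollsEvent hX _ _),
    hthen] at hle
  simp only [tailProb] at *
  linarith

theorem wordProb_le_one (hp : ∀ a, 0 ≤ p a) (hindep : iIndepFun X μ)
    (hlaw : ∀ i a, μ {ω | X i ω = a} = ENNReal.ofReal (p a)) (w : List (Fin m)) :
    wordProb p w ≤ 1 := by
  rw [← ENNReal.ofReal_le_one, ← measure_rollsEvent_singleton hp hindep hlaw w]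
  exact prob_le_one

/-- The event of avoiding S for k rolls and then rolling S splits according to the overlap R
completing the first occurrence; the piece for R has probability a_{k+|R|} P(S) / P(R). -/
theorem tailProb_eq_sum_overlaps (hp : ∀ a, 0 ≤ p a) (hX : ∀ i, Measurable (X i))
    (hindep : iIndepFun X μ) (hlaw : ∀ i a, μ {ω | X i ω = a} = ENNReal.ofReal (p a))
    (hS : 0 < wordProb p S) (k : ℕ) :
    tailProb μ X S k = ∑ R ∈ overlaps S, firstProb μ X S (k + R.length) / wordProb p R := by
  have hset : rollsThenEvent X k (avoidingWords S) S = ⋃ R ∈ overlaps S,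
      rollsThenEvent X (k + R.length) (endWords S) (S.drop R.length) := by
    ext ω
    simp only [rollsThenEvent, Set.mem_ofPred_eq, Set.mem_iUnion, exists_prop]
    exact avoiding_and_append_iff S _ k
  have hthen := measureReal_rollsThenEvent hp hX hindep hlaw k (avoidingWords S) S
  rw [hset, measureReal_biUnion_finset] at hthen
  · rw [tailProb, ← mul_div_cancel_right₀ (μ.real (rollsEvent X k (avoidingWords S))) hS.ne',
      ← hthen, Finset.sum_div]
    refine Finset.sum_congr rfl fun R hR => ?_
    have hfac : wordProb p R * wordProb p (S.drop R.length) = wordProb p S := by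
      rw [← wordProb_append, eq_append_drop_of_mem_overlaps hR]
    rw [measureReal_rollsThenEvent hp hX hindep hlaw, ← hfac, firstProb]
    rw [← hfac] at hS
    exact mul_div_mul_right _ _ (right_ne_zero_of_mul hS.ne')
  -- The first occurrence time fixes |R|, and prefixes of S of equal length coincide.
  · intro R hR R' hR' hne
    refine Set.disjoint_left.2 fun ω h h' => hne ?_
    have hlen := eq_of_firstRolls_mem_endWords h.1 h'.1
    have h1 := ((mem_overlaps _ _).1 hR).2.1
    have h2 := ((mem_overlaps _ _).1 hR').2.1
    exact (List.prefix_of_prefix_length_le h1 h2 (by omega)).eq_of_length (by omega)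
  · intro R _
    rw [rollsThenEvent_eq]
    exact measurableSet_rollsEvent hX _ _

end Rolls

/-! ### Moments of the waiting time. -/

section Moments

variable {m : ℕ} {Ω : Type*} [MeasurableSpace Ω] {μ : Measure Ω} {p : Fin m → ℝ}
  {X : ℕ → Ω → Fin m} {S : List (Fin m)}

/-- Applied twice: with pieces indexed by the value of Y, and by the words of Z(S). -/
theorem rollMoment_eq_tsum {ι : Type*} [Countable ι] (A : ι → Set Ω) (c : ι → ℕ) (n : ℕ)
    (hA : ∀ i, MeasurableSet (A i)) (hdisj : Pairwise (Function.onFun Disjoint A))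
    (hae : ∀ᵐ ω ∂μ, ∃ i, ω ∈ A i)
    (hc : ∀ i, ∀ ω ∈ A i, rollCount S (fun i => X i ω) = c i) :
    rollMoment μ X S n = ∑' i, (c i : ℝ≥0∞) ^ n * μ (A i) := by
  have huniv : (⋃ i, A i : Set Ω) =ᵐ[μ] Set.univ := by
    rw [Filter.eventuallyEq_univ]
    filter_upwards [hae] with ω h
    exact Set.mem_iUnion.2 h
  rw [rollMoment, ← setLIntegral_univ, ← setLIntegral_congr huniv, lintegral_iUnion hA hdisj]
  refine tsum_congr fun i => ?_
  rw [setLIntegral_congr_fun (g := fun _ => (c i : ℝ≥0∞) ^ n) (hA i), setLIntegral_const]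
  intro ω hω
  simp [hc i ω hω]

variable [IsProbabilityMeasure μ]

theorem exists_tailProb_le_geometric (hp : ∀ a, 0 ≤ p a) (hX : ∀ i, Measurable (X i))
    (hindep : iIndepFun X μ) (hlaw : ∀ i a, μ {ω | X i ω = a} = ENNReal.ofReal (p a))
    (hS : 0 < wordProb p S) :
    ∃ C ρ : ℝ, 0 < ρ ∧ ρ < 1 ∧ ∀ k, tailProb μ X S k ≤ C * ρ ^ k :=
  exists_geometric_bound (fun _ => measureReal_nonneg) (fun _ => measureReal_le_one)
    (fun _ _ h => measureReal_mono (rollsEvent_avoidingWords_antitone h)) hS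
    (wordProb_le_one hp hindep hlaw S) (tailProb_add_length_le hp hX hindep hlaw)

theorem ae_exists_mem_endWords (hp : ∀ a, 0 ≤ p a) (hX : ∀ i, Measurable (X i))
    (hindep : iIndepFun X μ) (hlaw : ∀ i a, μ {ω | X i ω = a} = ENNReal.ofReal (p a))
    (hS : 0 < wordProb p S) :
    ∀ᵐ ω ∂μ, ∃ k, firstRolls (fun i => X i ω) k ∈ endWords S := by
  obtain ⟨C, ρ, hρ, hρ1, hC⟩ := exists_tailProb_le_geometric hp hX hindep hlaw hS
  have hlim : Filter.Tendsto (fun k => C * ρ ^ k) Filter.atTop (nhds 0) := by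
    simpa using (tendsto_pow_atTop_nhds_zero_of_lt_one hρ.le hρ1).const_mul C
  -- The event that S never appears lies in every tail event, and their probabilities tend to 0.
  rw [ae_iff, ← measureReal_eq_zero_iff]
  refine le_antisymm (ge_of_tendsto' hlim fun k => ?_) measureReal_nonneg
  refine (measureReal_mono fun ω h => ?_).trans (hC k)
  rw [Set.mem_ofPred_eq, exists_mem_endWords_iff, not_not] at h
  exact h k

theorem rollMoment_eq_tsum_firstProb (hp : ∀ a, 0 ≤ p a) (hX : ∀ i, Measurable (X i))
    (hindep : iIndepFun X μ) (hlaw : ∀ i a, μ {ω | X i ω = a} = ENNReal.ofReal (p a))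
    (hS : 0 < wordProb p S) (n : ℕ) :
    rollMoment μ X S n = ∑' k : ℕ, ENNReal.ofReal ((k : ℝ) ^ n * firstProb μ X S k) := by
  rw [rollMoment_eq_tsum (fun k => rollsEvent X k (endWords S)) id n
    (fun k => measurableSet_rollsEvent hX _ _) ?_ (ae_exists_mem_endWords hp hX hindep hlaw hS)
    fun k ω h => rollCount_eq_of_mem_endWords h]
  · refine tsum_congr fun k => ?_
    rw [ENNReal.ofReal_mul (by positivity), ENNReal.ofReal_pow (by positivity),
      ENNReal.ofReal_natCast, firstProb, ofReal_measureReal, id]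
  · exact fun j k hne => Set.disjoint_left.2 fun ω h h' => hne (eq_of_firstRolls_mem_endWords h h')

theorem rollMoment_eq_tsum_endWords (hp : ∀ a, 0 ≤ p a) (hX : ∀ i, Measurable (X i))
    (hindep : iIndepFun X μ) (hlaw : ∀ i a, μ {ω | X i ω = a} = ENNReal.ofReal (p a))
    (hS : 0 < wordProb p S) (n : ℕ) :
    rollMoment μ X S n = ∑' w : endWords S,
      ENNReal.ofReal (((w : List (Fin m)).length : ℝ) ^ n * wordProb p w) := by
  have hmem : ∀ w : endWords S, ∀ ω ∈ rollsEvent X w.1.length {w.1},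
      firstRolls (fun i => X i ω) w.1.length = w.1 ∧
        firstRolls (fun i => X i ω) w.1.length ∈ endWords S := fun w ω h =>
    ⟨h, Set.mem_of_eq_of_mem h w.2⟩
  rw [rollMoment_eq_tsum (fun w : endWords S => rollsEvent X w.1.length {w.1})
    (fun w => w.1.length) n (fun k => measurableSet_rollsEvent hX _ _) ?_ ?_
    fun w ω h => rollCount_eq_of_mem_endWords (hmem w ω h).2]
  · refine tsum_congr fun w => ?_
    rw [ENNReal.ofReal_mul (by positivity), ENNReal.ofReal_pow (by positivity),
      ENNReal.ofReal_natCast, measure_rollsEvent_singleton hp hindep hlaw]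
  · intro w w' hne
    refine Set.disjoint_left.2 fun ω h h' => hne (Subtype.ext ?_)
    rw [← (hmem w ω h).1, ← (hmem w' ω h').1,
      eq_of_firstRolls_mem_endWords (hmem w ω h).2 (hmem w' ω h').2]
  · filter_upwards [ae_exists_mem_endWords hp hX hindep hlaw hS] with ω ⟨k, hk⟩
    exact ⟨⟨_, hk⟩, by simp [rollsEvent]⟩

theorem summable_pow_mul_tailProb (hp : ∀ a, 0 ≤ p a) (hX : ∀ i, Measurable (X i))
    (hindep : iIndepFun X μ) (hlaw : ∀ i a, μ {ω | X i ω = a} = ENNReal.ofReal (p a))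
    (hS : 0 < wordProb p S) (n : ℕ) : Summable fun k : ℕ => (k : ℝ) ^ n * tailProb μ X S k := by
  obtain ⟨C, ρ, hρ, hρ1, hC⟩ := exists_tailProb_le_geometric hp hX hindep hlaw hS
  exact summable_pow_mul_of_geometric_bound (fun _ => measureReal_nonneg) hρ hρ1 hC n

theorem summable_pow_mul_firstProb (hp : ∀ a, 0 ≤ p a) (hX : ∀ i, Measurable (X i))
    (hindep : iIndepFun X μ) (hlaw : ∀ i a, μ {ω | X i ω = a} = ENNReal.ofReal (p a))
    (hS : 0 < wordProb p S) (n : ℕ) : Summable fun k : ℕ => (k : ℝ) ^ n * firstProb μ X S k :=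
  summable_pow_mul_of_le_of_summable (fun _ => measureReal_nonneg)
    (fun k => by
      rw [tailProb_eq_succ_add hX k]
      exact le_add_of_nonneg_left measureReal_nonneg)
    (summable_pow_mul_tailProb hp hX hindep hlaw hS) n

theorem firstProb_moment_eq_sum_finpartition (hp : ∀ a, 0 ≤ p a) (hX : ∀ i, Measurable (X i))
    (hindep : iIndepFun X μ) (hlaw : ∀ i a, μ {ω | X i ω = a} = ENNReal.ofReal (p a))
    (hS : 0 < wordProb p S) (n : ℕ) :
    ∑' k : ℕ, (k : ℝ) ^ n * firstProb μ X S k =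
      ∑ π : Finpartition (Finset.univ : Finset (Fin n)),
        (π.parts.card.factorial : ℝ) * ∏ B ∈ π.parts, ∑ R ∈ overlaps S,
          ((1 - (R.length : ℝ)) ^ B.card - (-(R.length : ℝ)) ^ B.card) / wordProb p R := by
  set c : ℕ → ℝ := fun i => ∑ R ∈ overlaps S,
    ((1 - (R.length : ℝ)) ^ i - (-(R.length : ℝ)) ^ i) / wordProb p R with hc
  have hrec := moment_recurrence (O := overlaps S) (r := List.length) (P := wordProb p)
    (firstProb_add_tailProb_zero (μ := μ) (S := S) hX) (tailProb_eq_succ_add hX)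
    (fun R hR k hk => firstProb_eq_zero_of_lt
      (hk.trans_le ((mem_overlaps _ _).1 hR).2.1.length_le))
    (tailProb_eq_sum_overlaps hp hX hindep hlaw hS)
    (summable_pow_mul_firstProb hp hX hindep hlaw hS)
    (summable_pow_mul_tailProb hp hX hindep hlaw hS)
  have := orderedPartitionSum_eq_of_recurrence c
    (fun n => ∑' k : ℕ, (k : ℝ) ^ n * firstProb μ X S k) (by simp [hc]) hrec
    (Finset.univ : Finset (Fin n))
  rw [Finset.card_univ, Fintype.card_fin] at this
  rw [← this, orderedPartitionSum, ← sum_finpartition_eq_sum_partitionFamilies]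

theorem rollMoment_eq_ofReal_sum_finpartition (hp : ∀ a, 0 ≤ p a) (hX : ∀ i, Measurable (X i))
    (hindep : iIndepFun X μ) (hlaw : ∀ i a, μ {ω | X i ω = a} = ENNReal.ofReal (p a))
    (hS : 0 < wordProb p S) (n : ℕ) :
    rollMoment μ X S n = ENNReal.ofReal
      (∑ π : Finpartition (Finset.univ : Finset (Fin n)),
        (π.parts.card.factorial : ℝ) * ∏ B ∈ π.parts, ∑ R ∈ overlaps S,
          ((1 - (R.length : ℝ)) ^ B.card - (-(R.length : ℝ)) ^ B.card) / wordProb p R) := by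
  rw [rollMoment_eq_tsum_firstProb hp hX hindep hlaw hS,
    ← firstProb_moment_eq_sum_finpartition hp hX hindep hlaw hS,
    ENNReal.ofReal_tsum_of_nonneg _ (summable_pow_mul_firstProb hp hX hindep hlaw hS n)]
  exact fun k => mul_nonneg (by positivity) measureReal_nonneg

/-- Some letter of S has probability 0 and almost surely is never rolled, so Y = ∞; n ≥ 1 matters
because ∞^0 = 1. -/
theorem rollMoment_eq_top (hlaw : ∀ i a, μ {ω | X i ω = a} = ENNReal.ofReal (p a))
    (hS : wordProb p S = 0) {n : ℕ} (hn : 1 ≤ n) : rollMoment μ X S n = ∞ := by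
  obtain ⟨a, haS, ha⟩ : ∃ a ∈ S, p a = 0 := by
    simpa [wordProb, List.prod_eq_zero_iff] using hS
  have hae : ∀ᵐ ω ∂μ, ∀ i, X i ω ≠ a := by
    rw [ae_all_iff]
    intro i
    rw [ae_iff]
    simp only [not_not]
    rw [hlaw, ha, ENNReal.ofReal_zero]
  have htop : ∀ᵐ ω ∂μ, ((rollCount S (fun i => X i ω) : ℕ∞) : ℝ≥0∞) ^ n = ∞ := by
    filter_upwards [hae] with ω h
    have : rollCount S (fun i => X i ω) = ⊤ := by
      simp only [rollCount, iInf_eq_top]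
      intro k hk
      have hmem := hk.subset haS
      rw [firstRolls_eq_map_range, List.mem_map] at hmem
      obtain ⟨i, -, hi⟩ := hmem
      exact absurd hi (h i)
    rw [this, ENat.toENNReal_top, ENNReal.top_pow (by omega)]
  rw [rollMoment, lintegral_congr_ae htop, lintegral_const, measure_univ, mul_one]

end Moments

/-! ### The moment formula and invariance under reversal. -/

theorem mainTheorem1 {m : ℕ} (p : Fin m → ℝ) (hp : ∀ a, 0 ≤ p a) (hp1 : ∑ a, p a = 1)
    {Ω : Type*} [MeasurableSpace Ω] (μ : Measure Ω) [IsProbabilityMeasure μ]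
    (X : ℕ → Ω → Fin m) (hX : ∀ i, Measurable (X i)) (hindep : iIndepFun X μ)
    (hlaw : ∀ i a, μ {ω | X i ω = a} = ENNReal.ofReal (p a))
    (S : List (Fin m)) (n : ℕ) (hn : 1 ≤ n) :
    (0 < wordProb p S →
      rollMoment μ X S n ≠ ∞ ∧
      (rollMoment μ X S n).toReal =
        ∑ π : Finpartition (Finset.univ : Finset (Fin n)),
          (π.parts.card.factorial : ℝ) * ∏ B ∈ π.parts, ∑ R ∈ overlaps S,
            ((1 - (R.length : ℝ)) ^ B.card - (-(R.length : ℝ)) ^ B.card) / wordProb p R ∧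
      HasSum (fun w : endWords S => ((w : List (Fin m)).length : ℝ) ^ n * wordProb p w)
        (rollMoment μ X S n).toReal) ∧
    rollMoment μ X S.reverse n = rollMoment μ X S n := by
  refine ⟨fun hS => ?_, ?_⟩
  · have heq := rollMoment_eq_ofReal_sum_finpartition hp hX hindep hlaw hS n
    have hne : rollMoment μ X S n ≠ ∞ := heq ▸ ENNReal.ofReal_ne_top
    refine ⟨hne, ?_, ?_⟩
    · rw [heq, ENNReal.toReal_ofReal]
      rw [← firstProb_moment_eq_sum_finpartition hp hX hindep hlaw hS]
      exact tsum_nonneg fun k => mul_nonneg (by positivity) measureReal_nonneg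
    · have hsum := rollMoment_eq_tsum_endWords hp hX hindep hlaw hS n
      have h := ENNReal.hasSum_toReal (hsum ▸ hne)
      rw [← ENNReal.tsum_toReal_eq fun _ => ENNReal.ofReal_ne_top, ← hsum] at h
      refine h.congr_fun fun w => ?_
      rw [ENNReal.toReal_ofReal (mul_nonneg (by positivity) (wordProb_nonneg hp _))]
  · rcases (wordProb_nonneg hp S).eq_or_lt with hS | hS
    · rw [rollMoment_eq_top hlaw hS.symm hn,
        rollMoment_eq_top hlaw ((wordProb_reverse p S).trans hS.symm) hn]
    · rw [rollMoment_eq_ofReal_sum_finpartition hp hX hindep hlaw hS,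
        rollMoment_eq_ofReal_sum_finpartition hp hX hindep hlaw
          (by rwa [wordProb_reverse])]
      congr 1
      refine Finset.sum_congr rfl fun π _ => ?_
      congr 1
      refine Finset.prod_congr rfl fun B _ => ?_
      exact sum_overlaps_reverse S fun r P => ((1 - (r : ℝ)) ^ B.card - (-(r : ℝ)) ^ B.card) / P
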